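/- Let $G$ be a compact Hausdorff topological group and let $E$ be an operator space, that is, a closed subspace of the space $\mathcal{B}(\mathcal{H})$ of bounded operators on a complex Hilbert space $\mathcal{H}$, where $M_n(E)$ carries the norm of $\mathcal{B}(\ell^2_{\mathcal{H}}(n))$. Let $\widehat{G}$ be the dual object of $G$ (the set of equivalence classes of irreducible continuous unitary representations $\pi$, of degree $d_\pi$, with a fixed representative $\pi : G \to U(\mathbb{C}^{d_\pi})$ of each class). Let $\mathcal{L}^\infty_E(\widehat{G})$ be the space of families $A = (A^\pi)_{\pi\in\widehat{G}}$ with $A^\pi \in M_{d_\pi}(E)$ and $\sup_\pi \|A^\pi\|_{M_{d_\pi}(E)} < \infty$, normed at the matrix levels by $\|(A_{ij})\|_{M_n(\mathcal{L}^\infty_E(\widehat{G}))} = \sup_\pi \|(A_{ij}^\pi)\|_{M_n(M_{d_\pi}(E))}$, where $M_n(M_{d}(E)) = M_{nd}(E)$. Let $\mathcal{L}^1(\widehat{G})$ be the space of families $B = (B^\pi)_{\pi\in\widehat{G}}$ of complex $d_\pi \times d_\pi$ matrices with $\sum_\pi d_\pi \operatorname{tr}|B^\pi| < \infty$, with the operator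 space structure induced by its inclusion in $\mathcal{L}^\infty_{\mathbb{C}}(\widehat{G})^\star = cb(\mathcal{L}^\infty_{\mathbb{C}}(\widehat{G}),\mathbb{C})$ under the pairing $\langle X, B\rangle = \sum_\pi d_\pi \operatorname{tr}(X^\pi B^\pi)$. For operator spaces $E_1, E_2$ let $cb(E_1,E_2)$ be the space of completely bounded linear maps with the operator space structure given by $M_n(cb(E_1,E_2)) = cb(E_1,M_n(E_2))$. Then the formula $$\Lambda(A)(B) = \sum_{\pi\in\widehat{G}} d_\pi \operatorname{tr}(A^\pi B^\pi) \qquad (A \in \mathcal{L}^\infty_E(\widehat{G}),\ B \in \mathcal{L}^1(\widehat{G})),$$ in which the series converges unconditionally in $E$, defines a completely isometric isomorphism $\Lambda$ from $\mathcal{L}^\infty_E(\widehat{G})$ onto $cb(\mathcal{L}^1(\widehat{G}),E)$: a linear bijection such that $\|(\Lambda(A_{ij}))\|_{M_n(cb(\mathcal{L}^1(\widehat{G}),E))} = \|(A_{ij})\|_{M_n(\mathcal{L}^\infty_E(\widehat{G}))}$ for all $n \ge 1$ and all $n\times n$ matrices $(A_{ij})$ over $\mathcal{L}^\infty_E(\widehat{G})$.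 -/

import Mathlib

noncomputable section

namespace OpSpace

universe u v w

/-! ## Matrix norms, completely bounded maps -/

/-- Data of matrix norms on a complex vector space `V`: a norm on the square matrices with entries
in `V`, for every finite index set. It is only used through the concrete instances below: spaces of
operators on a Hilbert space, the scalars, spaces of matrices, spaces of completely bounded maps,
`L^∞` and `L^1` of the dual object. -/
class MatrixNorm (V : Type*) where
  /-- the norm of a square matrix with entries in `V` -/
  mnorm : ∀ {ι : Type} [Fintype ι], Matrix ι ι V → ℝ

open MatrixNorm (mnorm)

/-- The matrix norms are subadditive and absolutely homogeneous. -/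
class IsMatrixSeminorm (V : Type*) [AddCommGroup V] [Module ℂ V] [MatrixNorm V] : Prop where
  mnorm_add_le : ∀ {ι : Type} [Fintype ι] (A B : Matrix ι ι V), mnorm (A + B) ≤ mnorm A + mnorm B
  mnorm_smul : ∀ {ι : Type} [Fintype ι] (c : ℂ) (A : Matrix ι ι V), mnorm (c • A) = ‖c‖ * mnorm A

section Concrete

variable {H : Type v} [NormedAddCommGroup H] [NormedSpace ℂ H]

/-- A matrix of operators on `H`, as an operator on the space `ℓ²(ι; H)` (a Hilbert space if `H`
is one): `(A x) i = ∑ j, A i j (x j)`. -/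
def blockOp {ι : Type} [Fintype ι] (A : Matrix ι ι (H →L[ℂ] H)) :
    PiLp 2 (fun _ : ι => H) →L[ℂ] PiLp 2 (fun _ : ι => H) :=
  (PiLp.continuousLinearEquiv 2 ℂ (fun _ : ι => H)).symm.toContinuousLinearMap ∘L
    ContinuousLinearMap.pi fun i => ∑ j, (A i j) ∘L PiLp.proj 2 (fun _ : ι => H) j

theorem blockOp_apply {ι : Type} [Fintype ι] (A : Matrix ι ι (H →L[ℂ] H))
    (x : PiLp 2 (fun _ : ι => H)) (i : ι) : blockOp A x i = ∑ j, A i j (x j) := by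
  simp [blockOp]

theorem blockOp_add {ι : Type} [Fintype ι] (A B : Matrix ι ι (H →L[ℂ] H)) :
    blockOp (A + B) = blockOp A + blockOp B := by
  ext x i
  simp [blockOp_apply, Finset.sum_add_distrib]

theorem blockOp_smul {ι : Type} [Fintype ι] (c : ℂ) (A : Matrix ι ι (H →L[ℂ] H)) :
    blockOp (c • A) = c • blockOp A := by
  ext x i
  simp [blockOp_apply, Finset.smul_sum]

theorem norm_blockOp_add_le {ι : Type} [Fintype ι] (A B : Matrix ι ι (H →L[ℂ] H)) :
    ‖blockOp (A + B)‖ ≤ ‖blockOp A‖ + ‖blockOp B‖ := by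
  rw [blockOp_add]
  exact norm_add_le _ _

theorem norm_blockOp_smul {ι : Type} [Fintype ι] (c : ℂ) (A : Matrix ι ι (H →L[ℂ] H)) :
    ‖blockOp (c • A)‖ = ‖c‖ * ‖blockOp A‖ := by
  rw [blockOp_smul]
  exact norm_smul _ _

end Concrete

section OperatorSubspace

variable {H : Type v} [NormedAddCommGroup H] [InnerProductSpace ℂ H]

/-- A space of operators `E ⊆ B(H)`: `M_ι(E)` carries the norm of `B(ℓ²(ι; H))`. -/
instance (E : Submodule ℂ (H →L[ℂ] H)) : MatrixNorm E where
  mnorm A := ‖blockOp (A.map (fun a => (a : H →L[ℂ] H)))‖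

instance (E : Submodule ℂ (H →L[ℂ] H)) : IsMatrixSeminorm E where
  mnorm_add_le A B := norm_blockOp_add_le (A.map (fun a => (a : H →L[ℂ] H))) (B.map (fun a => a))
  mnorm_smul c A := norm_blockOp_smul c (A.map (fun a => (a : H →L[ℂ] H)))

end OperatorSubspace

/-- The scalars `ℂ = B(ℂ)`: `M_ι(ℂ)` carries the operator norm of `B(ℓ²(ι))`. -/
instance : MatrixNorm ℂ where
  mnorm A := ‖blockOp (A.map (algebraMap ℂ (ℂ →L[ℂ] ℂ)))‖

instance : IsMatrixSeminorm ℂ where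
  mnorm_add_le A B := by
    have : blockOp ((A + B).map (algebraMap ℂ (ℂ →L[ℂ] ℂ))) =
        blockOp (A.map (algebraMap ℂ (ℂ →L[ℂ] ℂ))) +
          blockOp (B.map (algebraMap ℂ (ℂ →L[ℂ] ℂ))) := by
      rw [← blockOp_add]; congr 1; ext i j; simp
    change ‖_‖ ≤ ‖_‖ + ‖_‖
    rw [this]
    exact norm_add_le _ _
  mnorm_smul c A := by
    have : blockOp ((c • A).map (algebraMap ℂ (ℂ →L[ℂ] ℂ))) =
        c • blockOp (A.map (algebraMap ℂ (ℂ →L[ℂ] ℂ))) := by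
      rw [← blockOp_smul]; congr 1; ext i j; simp
    change ‖_‖ = _ * ‖_‖
    rw [this, norm_smul]

/-- `M_n(M_κ(V)) = M_{n × κ}(V)`: the matrix norms of the space `S_κ^∞(V) = M_κ(V)`. -/
instance (κ : Type) [Fintype κ] (V : Type*) [MatrixNorm V] : MatrixNorm (Matrix κ κ V) where
  mnorm A := mnorm (Matrix.comp _ _ _ _ V A)

section CB

variable {V : Type*} [AddCommGroup V] [Module ℂ V] [MatrixNorm V]
variable {W : Type*} [AddCommGroup W] [Module ℂ W] [MatrixNorm W]

/-- `‖I_{M_n} ⊗ u : M_n(V) → M_n(W)‖ ≤ C` for every `n`. -/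
def CBBound (u : V →ₗ[ℂ] W) (C : ℝ) : Prop :=
  ∀ (n : ℕ) (A : Matrix (Fin n) (Fin n) V), mnorm (A.map u) ≤ C * mnorm A

/-- The `cb` norm `sup_n ‖I_{M_n} ⊗ u‖` of a completely bounded map, as the least bound. -/
def cbNorm (u : V →ₗ[ℂ] W) : ℝ := sInf {C : ℝ | 0 ≤ C ∧ CBBound u C}

end CB

/-- The space `cb(V, W)` of completely bounded linear maps. -/
def CB (V : Type*) [AddCommGroup V] [Module ℂ V] [MatrixNorm V]
    (W : Type*) [AddCommGroup W] [Module ℂ W] [MatrixNorm W] [IsMatrixSeminorm W] :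
    Submodule ℂ (V →ₗ[ℂ] W) where
  carrier := {u | ∃ C : ℝ, 0 ≤ C ∧ CBBound u C}
  add_mem' := by
    rintro a b ⟨C, hC, h⟩ ⟨D, hD, k⟩
    refine ⟨C + D, add_nonneg hC hD, fun n A => ?_⟩
    have e : A.map (a + b : V →ₗ[ℂ] W) = A.map a + A.map b := by ext i j; simp
    rw [e, add_mul]
    exact (IsMatrixSeminorm.mnorm_add_le _ _).trans (add_le_add (h n A) (k n A))
  zero_mem' := by
    refine ⟨0, le_rfl, fun n A => ?_⟩
    have e : A.map (0 : V →ₗ[ℂ] W) = (0 : ℂ) • (0 : Matrix (Fin n) (Fin n) W) := by ext i j; simp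
    rw [e, IsMatrixSeminorm.mnorm_smul]
    simp
  smul_mem' := by
    rintro c a ⟨C, hC, h⟩
    refine ⟨‖c‖ * C, mul_nonneg (norm_nonneg _) hC, fun n A => ?_⟩
    have e : A.map (c • a : V →ₗ[ℂ] W) = c • A.map a := by ext i j; simp
    rw [e, IsMatrixSeminorm.mnorm_smul, mul_assoc]
    exact mul_le_mul_of_nonneg_left (h n A) (norm_nonneg _)

/-- A matrix of linear maps, as a linear map into the matrices: `v ↦ (u_ij v)`. -/
def matrixOfMaps {V W ι : Type*} [AddCommGroup V] [Module ℂ V] [AddCommGroup W] [Module ℂ W]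
    (U : Matrix ι ι (V →ₗ[ℂ] W)) : V →ₗ[ℂ] Matrix ι ι W where
  toFun v := Matrix.of fun i j => U i j v
  map_add' x y := by ext i j; simp
  map_smul' c x := by ext i j; simp

/-- The operator space structure of `cb(V, W)`: `M_ι(cb(V, W))` is normed as `cb(V, M_ι(W))`. -/
instance (V : Type*) [AddCommGroup V] [Module ℂ V] [MatrixNorm V]
    (W : Type*) [AddCommGroup W] [Module ℂ W] [MatrixNorm W] [IsMatrixSeminorm W] :
    MatrixNorm (CB V W) where
  mnorm U := cbNorm (matrixOfMaps (U.map fun a => (a : V →ₗ[ℂ] W)))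

/-- A (linear) map is completely isometric if all its amplifications to `n × n` matrices preserve
the norms. -/
def IsCompleteIsometry {V : Type*} [MatrixNorm V] {W : Type*} [MatrixNorm W]
    (u : V → W) : Prop :=
  ∀ (n : ℕ) (A : Matrix (Fin n) (Fin n) V), mnorm (A.map u) = mnorm A

/-! ## The dual object of a topological group -/

/-- The representation on `ℂ^n` given by a homomorphism into the unitary matrices. -/
def toRep {G : Type u} [Group G] {n : ℕ} (π : G →* Matrix.unitaryGroup (Fin n) ℂ) :
    Representation ℂ G (Fin n → ℂ) where
  toFun g := Matrix.toLin' (π g : Matrix (Fin n) (Fin n) ℂ)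
  map_one' := by simp [Module.End.one_eq_id]
  map_mul' g h := by simp [Matrix.toLin'_mul, Module.End.mul_eq_comp]

/-- A continuous irreducible unitary representation `π : G → U(ℂ^d)`. -/
structure UnitaryIrrep (G : Type u) [Group G] [TopologicalSpace G] where
  /-- the degree -/
  deg : ℕ
  /-- the homomorphism into the unitary matrices -/
  hom : G →* Matrix.unitaryGroup (Fin deg) ℂ
  continuous_hom : Continuous hom
  irreducible : (toRep hom).IsIrreducible

/-- The unitary matrix `π(g)`. -/
def UnitaryIrrep.mat {G : Type u} [Group G] [TopologicalSpace G] (π : UnitaryIrrep G) (g : G) :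
    Matrix (Fin π.deg) (Fin π.deg) ℂ := (π.hom g).1

/-- Unitary equivalence of irreducible unitary representations. -/
instance unitaryEquiv (G : Type u) [Group G] [TopologicalSpace G] : Setoid (UnitaryIrrep G) where
  r π σ := ∃ U : Matrix (Fin σ.deg) (Fin π.deg) ℂ,
    U.conjTranspose * U = 1 ∧ U * U.conjTranspose = 1 ∧
      ∀ g, U * π.mat g = σ.mat g * U
  iseqv :=
    { refl := fun π => ⟨1, by simp, by simp, by simp⟩
      symm := by
        rintro π σ ⟨U, h1, h2, h⟩
        refine ⟨U.conjTranspose, by simpa using h2, by simpa using h1, fun g => ?_⟩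
        calc U.conjTranspose * σ.mat g
            = U.conjTranspose * (σ.mat g * U) * U.conjTranspose := by
              rw [Matrix.mul_assoc, Matrix.mul_assoc, h2, Matrix.mul_one]
          _ = π.mat g * U.conjTranspose := by
              rw [← h g, ← Matrix.mul_assoc, h1, Matrix.one_mul]
      trans := by
        rintro π σ τ ⟨U, h1, h2, h⟩ ⟨V, k1, k2, k⟩
        refine ⟨V * U, ?_, ?_, fun g => ?_⟩
        · rw [Matrix.conjTranspose_mul, Matrix.mul_assoc, ← Matrix.mul_assoc V.conjTranspose, k1,
            Matrix.one_mul, h1]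
        · rw [Matrix.conjTranspose_mul, Matrix.mul_assoc, ← Matrix.mul_assoc U, h2,
            Matrix.one_mul, k2]
        · rw [Matrix.mul_assoc, h g, ← Matrix.mul_assoc, k g, Matrix.mul_assoc] }

/-- The dual object `Ĝ`: equivalence classes of irreducible unitary representations. -/
def DualObject (G : Type u) [Group G] [TopologicalSpace G] : Type u := Quotient (unitaryEquiv G)

/-- The degree `d_π` of a class `π` in the dual object. -/
def DualObject.deg {G : Type u} [Group G] [TopologicalSpace G] (π : DualObject G) : ℕ :=
  (Quotient.out π).deg

/-- The product `M_V(Ĝ) = ∏_π M_{d_π} ⊗ V`. -/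
abbrev MatrixFamily (G : Type u) [Group G] [TopologicalSpace G] (V : Type v) : Type (max u v) :=
  ∀ π : DualObject G, Matrix (Fin π.deg) (Fin π.deg) V

/-! ## The space `L^∞_V(Ĝ)` -/

/-- `L^∞_V(Ĝ)`: the families `A` with `sup_π ‖A^π‖_{S^∞_{d_π}(V)} < ∞`. -/
def LInf (G : Type u) [Group G] [TopologicalSpace G]
    (V : Type v) [AddCommGroup V] [Module ℂ V] [MatrixNorm V] [IsMatrixSeminorm V] :
    Submodule ℂ (MatrixFamily G V) where
  carrier := {A | ∃ C : ℝ, ∀ π, mnorm (A π) ≤ C}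
  add_mem' := by
    rintro a b ⟨C, h⟩ ⟨D, k⟩
    exact ⟨C + D, fun π => (IsMatrixSeminorm.mnorm_add_le _ _).trans (add_le_add (h π) (k π))⟩
  zero_mem' := by
    refine ⟨0, fun π => ?_⟩
    have := IsMatrixSeminorm.mnorm_smul (0 : ℂ) (0 : Matrix (Fin π.deg) (Fin π.deg) V)
    simpa using this.le
  smul_mem' := by
    rintro c a ⟨C, h⟩
    refine ⟨‖c‖ * C, fun π => ?_⟩
    have := IsMatrixSeminorm.mnorm_smul c (a π)
    rw [Pi.smul_apply, this]
    exact mul_le_mul_of_nonneg_left (h π) (norm_nonneg _)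

/-- The operator space structure of `L^∞_V(Ĝ)`, the `ℓ^∞` direct sum of the `S^∞_{d_π}(V)`:
`‖(A_ij)‖ = sup_π ‖(A_ij^π)‖_{M_n(S^∞_{d_π}(V))}`. -/
instance (G : Type u) [Group G] [TopologicalSpace G]
    (V : Type v) [AddCommGroup V] [Module ℂ V] [MatrixNorm V] [IsMatrixSeminorm V] :
    MatrixNorm (LInf G V) where
  mnorm A := ⨆ π : DualObject G, mnorm (A.map fun a => (a : MatrixFamily G V) π)

/-! ## The trace norm -/

section TraceNorm

variable {d : ℕ}

/-- The norm of `S^1_d`: `tr |A|`, that is, the sum of the square roots of the eigenvalues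
of `A* A`. -/
def traceNorm (A : Matrix (Fin d) (Fin d) ℂ) : ℝ :=
  ∑ i, √((Matrix.isHermitian_conjTranspose_mul_self A).eigenvalues i)

theorem norm_toEuclideanLin_eigenvectorBasis (A : Matrix (Fin d) (Fin d) ℂ) (i : Fin d) :
    ‖Matrix.toEuclideanLin A
        ((Matrix.isHermitian_conjTranspose_mul_self A).eigenvectorBasis i)‖ =
      √((Matrix.isHermitian_conjTranspose_mul_self A).eigenvalues i) := by
  set hA := Matrix.isHermitian_conjTranspose_mul_self A
  set v := hA.eigenvectorBasis i with hv
  have h1 : Matrix.toEuclideanLin (A.conjTranspose * A) v = (hA.eigenvalues i : ℂ) • v := by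
    ext k
    have := congrFun (hA.mulVec_eigenvectorBasis i) k
    simpa [Matrix.toLpLin_apply] using this
  have h2 : Matrix.toEuclideanLin (A.conjTranspose * A) v =
      LinearMap.adjoint (Matrix.toEuclideanLin A) (Matrix.toEuclideanLin A v) := by
    rw [← Matrix.toEuclideanLin_conjTranspose_eq_adjoint]
    ext k
    simp [Matrix.toLpLin_apply, Matrix.mulVec_mulVec]
  have h3 : inner ℂ (Matrix.toEuclideanLin A v) (Matrix.toEuclideanLin A v) =
      (hA.eigenvalues i : ℂ) := by
    rw [← LinearMap.adjoint_inner_right, ← h2, h1, inner_smul_right,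
      inner_self_eq_norm_sq_to_K, hA.eigenvectorBasis.orthonormal.1 i]
    simp
  rw [inner_self_eq_norm_sq_to_K] at h3
  have h4 : ‖Matrix.toEuclideanLin A v‖ ^ 2 = hA.eigenvalues i :=
    Complex.ofReal_injective (by rw [← h3]; simp)
  rw [← h4, Real.sqrt_sq (norm_nonneg _)]

theorem traceNorm_nonneg (A : Matrix (Fin d) (Fin d) ℂ) : 0 ≤ traceNorm A :=
  Finset.sum_nonneg fun _ _ => Real.sqrt_nonneg _

/-- `|tr (T A)| ≤ ‖T‖ tr |A|`. -/
theorem norm_trace_comp_le (T : EuclideanSpace ℂ (Fin d) →ₗ[ℂ] EuclideanSpace ℂ (Fin d)) {C : ℝ}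
    (hT : ∀ x, ‖T x‖ ≤ C * ‖x‖) (A : Matrix (Fin d) (Fin d) ℂ) :
    ‖LinearMap.trace ℂ _ (T ∘ₗ Matrix.toEuclideanLin A)‖ ≤ C * traceNorm A := by
  set hA := Matrix.isHermitian_conjTranspose_mul_self A
  rw [LinearMap.trace_eq_sum_inner _ hA.eigenvectorBasis, traceNorm, Finset.mul_sum]
  refine (norm_sum_le _ _).trans (Finset.sum_le_sum fun i _ => ?_)
  refine (norm_inner_le_norm _ _).trans ?_
  rw [hA.eigenvectorBasis.orthonormal.1 i, one_mul, LinearMap.comp_apply,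
    ← norm_toEuclideanLin_eigenvectorBasis]
  exact hT _

/-- There is a contraction `T` with `tr (T A) = tr |A|`. -/
theorem exists_trace_comp_eq (A : Matrix (Fin d) (Fin d) ℂ) :
    ∃ T : EuclideanSpace ℂ (Fin d) →ₗ[ℂ] EuclideanSpace ℂ (Fin d), (∀ x, ‖T x‖ ≤ 1 * ‖x‖) ∧
      LinearMap.trace ℂ _ (T ∘ₗ Matrix.toEuclideanLin A) = (traceNorm A : ℂ) := by
  set hA := Matrix.isHermitian_conjTranspose_mul_self A with hhA
  set v := hA.eigenvectorBasis with hv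
  set L := Matrix.toEuclideanLin A with hL
  have hn : ∀ i, ‖L (v i)‖ = √(hA.eigenvalues i) := norm_toEuclideanLin_eigenvectorBasis A
  have hor : ∀ i j, i ≠ j → inner ℂ (L (v i)) (L (v j)) = 0 := by
    intro i j hij
    have h1 : LinearMap.adjoint L (L (v j)) = (hA.eigenvalues j : ℂ) • v j := by
      rw [hL, ← Matrix.toEuclideanLin_conjTranspose_eq_adjoint]
      ext k
      have := congrFun (hA.mulVec_eigenvectorBasis j) k
      simpa [Matrix.toLpLin_apply, Matrix.mulVec_mulVec] using this
    rw [← LinearMap.adjoint_inner_right, h1, inner_smul_right, v.orthonormal.2 hij, mul_zero]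
  obtain ⟨f, hf⟩ := Orthonormal.exists_orthonormalBasis_extension_of_card_eq (𝕜 := ℂ)
    (E := EuclideanSpace ℂ (Fin d)) (ι := Fin d) (by simp)
    (v := fun i => ((‖L (v i)‖⁻¹ : ℝ) : ℂ) • L (v i)) (s := {i | L (v i) ≠ 0}) (by
      rw [orthonormal_iff_ite]
      rintro ⟨i, hi⟩ ⟨j, hj⟩
      have hi' : (‖L (v i)‖ : ℂ) ≠ 0 := by simpa using hi
      by_cases hij : i = j
      · subst hij
        rw [Set.domRestrict_apply, inner_smul_left, inner_smul_right,
          inner_self_eq_norm_sq_to_K]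
        simp
        field_simp
      · simp [Set.domRestrict_apply, inner_smul_left, inner_smul_right, hor i j hij, hij])
  refine ⟨(f.equiv v (Equiv.refl _)).toLinearIsometry.toLinearMap, fun x => ?_, ?_⟩
  · simp
  · rw [LinearMap.trace_eq_sum_inner _ v, traceNorm, Complex.ofReal_sum]
    refine Finset.sum_congr rfl fun i _ => ?_
    have h1 : v i = f.equiv v (Equiv.refl _) (f i) := by simp
    have h2 : inner ℂ (v i) (((f.equiv v (Equiv.refl _)).toLinearIsometry.toLinearMap ∘ₗ L) (v i)) =
        inner ℂ (f i) (L (v i)) := by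
      conv_lhs => rw [h1]
      exact (f.equiv v (Equiv.refl _)).inner_map_map (f i) (L (v i))  |> fun h => by
        simpa using h
    rw [h2, ← hn i]
    by_cases hi : L (v i) = 0
    · simp [hi]
    · rw [hf i hi, inner_smul_left, inner_self_eq_norm_sq_to_K]
      have hi' : (‖L (v i)‖ : ℂ) ≠ 0 := by simpa using hi
      simp
      field_simp

theorem traceNorm_add_le (A B : Matrix (Fin d) (Fin d) ℂ) :
    traceNorm (A + B) ≤ traceNorm A + traceNorm B := by
  obtain ⟨T, hT, h⟩ := exists_trace_comp_eq (A + B)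
  rw [map_add, LinearMap.comp_add, map_add] at h
  have h1 := norm_trace_comp_le T hT A
  have h2 := norm_trace_comp_le T hT B
  have h3 : ‖(traceNorm (A + B) : ℂ)‖ = traceNorm (A + B) := by
    simp [abs_of_nonneg (traceNorm_nonneg _)]
  rw [← h3, ← h]
  exact (norm_add_le _ _).trans (by linarith)

theorem traceNorm_smul_le (c : ℂ) (A : Matrix (Fin d) (Fin d) ℂ) :
    traceNorm (c • A) ≤ ‖c‖ * traceNorm A := by
  obtain ⟨T, hT, h⟩ := exists_trace_comp_eq (c • A)
  rw [map_smul, LinearMap.comp_smul, map_smul] at h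
  have h1 := norm_trace_comp_le T hT A
  have h3 : ‖(traceNorm (c • A) : ℂ)‖ = traceNorm (c • A) := by
    simp [abs_of_nonneg (traceNorm_nonneg _)]
  rw [← h3, ← h, norm_smul]
  exact mul_le_mul_of_nonneg_left (by linarith) (norm_nonneg _)

/-- `|tr (X B)| ≤ ‖X‖ tr |B|`. -/
theorem norm_trace_mul_le (X B : Matrix (Fin d) (Fin d) ℂ) :
    ‖(X * B).trace‖ ≤ mnorm X * traceNorm B := by
  have h := norm_trace_comp_le (Matrix.toEuclideanLin X) (C := mnorm X) (fun x => by
    have h0 := (blockOp (X.map (algebraMap ℂ (ℂ →L[ℂ] ℂ)))).le_opNorm x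
    have h1 : blockOp (X.map (algebraMap ℂ (ℂ →L[ℂ] ℂ))) x = Matrix.toEuclideanLin X x := by
      ext i
      rw [blockOp_apply]
      simp [Matrix.toLpLin_apply, Matrix.mulVec, dotProduct, Algebra.algebraMap_eq_smul_one]
    rwa [h1] at h0) B
  have h2 : LinearMap.trace ℂ _ (Matrix.toEuclideanLin X ∘ₗ Matrix.toEuclideanLin B) =
      (X * B).trace := by
    rw [← Matrix.toLpLin_mul_same (R := ℂ) 2 X B]
    exact Matrix.trace_toLin_eq (X * B) (PiLp.basisFun 2 ℂ (Fin d))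
  rwa [h2] at h

end TraceNorm

/-! ## The space `L^1(Ĝ)` -/

section LOne

variable (G : Type u) [Group G] [TopologicalSpace G]

/-- `L^1(Ĝ)`: the families `B` of scalar matrices with `∑_π d_π ‖B^π‖_{S^1_{d_π}} < ∞`. -/
def LOne : Submodule ℂ (MatrixFamily G ℂ) where
  carrier := {B | Summable fun π : DualObject G => (π.deg : ℝ) * traceNorm (B π)}
  add_mem' := by
    intro a b ha hb
    refine Summable.of_nonneg_of_le (fun π => mul_nonneg (Nat.cast_nonneg _) (traceNorm_nonneg _))
      (fun π => ?_) (Summable.add ha hb)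
    rw [← mul_add]
    exact mul_le_mul_of_nonneg_left (traceNorm_add_le _ _) (Nat.cast_nonneg _)
  zero_mem' := by
    have h : ∀ d : ℕ, traceNorm (0 : Matrix (Fin d) (Fin d) ℂ) = 0 := fun d =>
      le_antisymm (by simpa using traceNorm_smul_le 0 (0 : Matrix (Fin d) (Fin d) ℂ))
        (traceNorm_nonneg _)
    simp [h, summable_zero]
  smul_mem' := by
    intro c a ha
    refine Summable.of_nonneg_of_le (fun π => mul_nonneg (Nat.cast_nonneg _) (traceNorm_nonneg _))
      (fun π => ?_) (Summable.mul_left ‖c‖ ha)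
    rw [mul_left_comm]
    exact mul_le_mul_of_nonneg_left (traceNorm_smul_le _ _) (Nat.cast_nonneg _)

variable {G}

theorem summable_pairing (B : LOne G) (X : LInf G ℂ) :
    Summable fun π : DualObject G => (π.deg : ℂ) * (X.1 π * B.1 π).trace := by
  obtain ⟨C, hC⟩ := X.2
  refine Summable.of_norm_bounded (Summable.mul_left C B.2) fun π => ?_
  rw [norm_mul, Complex.norm_natCast, mul_left_comm]
  exact mul_le_mul_of_nonneg_left ((norm_trace_mul_le _ _).trans
    (mul_le_mul_of_nonneg_right (hC π) (traceNorm_nonneg _))) (Nat.cast_nonneg _)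

/-- The functional `X ↦ ∑_π d_π tr (X^π B^π)` on `L^∞(Ĝ)` given by `B ∈ L^1(Ĝ)`. -/
def pairing (B : LOne G) : LInf G ℂ →ₗ[ℂ] ℂ where
  toFun X := ∑' π : DualObject G, (π.deg : ℂ) * (X.1 π * B.1 π).trace
  map_add' X Y := by
    rw [← (summable_pairing B X).tsum_add (summable_pairing B Y)]
    refine tsum_congr fun π => ?_
    simp [Matrix.add_mul, mul_add]
  map_smul' c X := by
    rw [RingHom.id_apply, smul_eq_mul, ← tsum_mul_left]
    refine tsum_congr fun π => ?_
    simp [mul_left_comm]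

/-- The operator space structure of `L^1(Ĝ)`, the `ℓ^1` direct sum of the `S^1_{d_π}` with the
weights `d_π`: it is the one induced by the inclusion of `L^1(Ĝ)` in the dual
`L^∞(Ĝ)^* = cb(L^∞(Ĝ), ℂ)`, so `M_ι(L^1(Ĝ))` is normed as a subspace of `cb(L^∞(Ĝ), M_ι(ℂ))`. -/
instance : MatrixNorm (LOne G) where
  mnorm B := cbNorm (matrixOfMaps (B.map pairing))

end LOne

/-- `tr (A B)` for a matrix `A` with entries in `V` and a scalar matrix `B`. -/
def traceMul {V : Type*} [AddCommGroup V] [Module ℂ V] {d : ℕ}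
    (A : Matrix (Fin d) (Fin d) V) (B : Matrix (Fin d) (Fin d) ℂ) : V :=
  ∑ k, ∑ l, B l k • A k l

end OpSpace

end

open OpSpace

namespace OpSpace

open OpSpace.MatrixNorm (mnorm)

universe u v w

/-! ### Norms in finite `ℓ²` sums. -/

section EuclideanNorm

variable {H : Type v} [SeminormedAddCommGroup H] {ι κ : Type} [Fintype ι] [Fintype κ]

/-! The heart of the matter is `‖(Λ(A_ij)(B_pq))‖ ≤ ‖A‖ ‖B‖` together with matrices over `L^1` that
recover each `A^π`.

Upper bound (`mnorm_duality_le`). For scalar families this is the definition of the norm of `L^1`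
inside the dual of `L^∞`. For `E ⊆ B(H)`, a matrix norm is tested on two finite tuples of vectors of
`H`; these span a finite-dimensional space with orthonormal basis `h_1, …, h_r`. The coefficients
`⟨h_s, A_ij h_t⟩` form a larger matrix of scalar families of norm at most `‖A‖`
(`mnorm_coefficient_le`), and pairing it with `B` gives the tested number, so the scalar case
applies.

Lower bound and bijectivity. Let `dualUnits π` be the `d_π × d_π` matrix over `L^1` that represents,
as a map on `L^∞`, the projection `X ↦ X^π`. It has norm at most `1` (`mnorm_dualUnits_le`), and
`Λ(A)` sends it entrywise to `A^π`; this gives injectivity and `‖A‖ ≤ ‖Λ(A)‖`. For a completely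
bounded `u`, the images `A^π = u(dualUnits π)` are uniformly bounded, and `Λ(A)` agrees with `u` on
families supported at one point. A completely bounded map is bounded for the norm `∑ d_π tr|B^π|`,
so the two agree everywhere (`hasSum_lOneSingle`). -/

theorem norm_toLp_sq (x : ι → H) : ‖WithLp.toLp 2 x‖ ^ 2 = ∑ i, ‖x i‖ ^ 2 := by
  rw [PiLp.norm_sq_eq_of_L2]

theorem norm_toLp_eq {x : ι → H} {F : Type w} [SeminormedAddCommGroup F]
    {y : κ → F} (h : ∑ i, ‖x i‖ ^ 2 = ∑ k, ‖y k‖ ^ 2) :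
    ‖WithLp.toLp 2 x‖ = ‖WithLp.toLp 2 y‖ := by
  rw [← sq_eq_sq₀ (norm_nonneg _) (norm_nonneg _), norm_toLp_sq, norm_toLp_sq, h]

theorem norm_toLp_single [DecidableEq ι] (i : ι) (x : H) :
    ‖WithLp.toLp 2 (Pi.single i x : ι → H)‖ = ‖x‖ := by
  rw [← sq_eq_sq₀ (norm_nonneg _) (norm_nonneg _), norm_toLp_sq,
    Finset.sum_eq_single i (fun j _ hj => by simp [hj]) (by simp)]
  simp

theorem norm_toLp_le_of_prod (x : ι × κ → H) (i : ι) :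
    ‖WithLp.toLp 2 fun k => x (i, k)‖ ≤ ‖WithLp.toLp 2 x‖ := by
  rw [← sq_le_sq₀ (norm_nonneg _) (norm_nonneg _), norm_toLp_sq, norm_toLp_sq,
    Fintype.sum_prod_type]
  exact Finset.single_le_sum (f := fun i => ∑ k, ‖x (i, k)‖ ^ 2)
    (fun i _ => by positivity) (Finset.mem_univ i)

theorem norm_toLp_const_unit (x : H) : ‖WithLp.toLp 2 fun _ : Unit => x‖ = ‖x‖ := by
  rw [← sq_eq_sq₀ (norm_nonneg _) (norm_nonneg _), norm_toLp_sq]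
  simp

end EuclideanNorm

/-! ### Norms of operator matrices through their sesquilinear forms. -/

section BlockOp

variable {H : Type v} [NormedAddCommGroup H] [InnerProductSpace ℂ H]
variable {ι κ : Type} [Fintype ι] [Fintype κ]

theorem inner_blockOp (A : Matrix ι ι (H →L[ℂ] H)) (x y : PiLp 2 fun _ : ι => H) :
    inner ℂ y (blockOp A x) = ∑ i, ∑ j, inner ℂ (y i) (A i j (x j)) := by
  simp [PiLp.inner_apply, blockOp_apply, inner_sum]

theorem norm_sum_inner_le (A : Matrix ι ι (H →L[ℂ] H)) (x y : ι → H) :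
    ‖∑ i, ∑ j, inner ℂ (y i) (A i j (x j))‖ ≤
      ‖blockOp A‖ * ‖WithLp.toLp 2 x‖ * ‖WithLp.toLp 2 y‖ := by
  have h := inner_blockOp A (WithLp.toLp 2 x) (WithLp.toLp 2 y)
  simp only at h
  rw [← h]
  refine (norm_inner_le_norm _ _).trans ?_
  rw [mul_comm]
  exact mul_le_mul_of_nonneg_right ((blockOp A).le_opNorm _) (norm_nonneg _)

/-- Taking `y = A x` in the form bounds `‖A x‖ ^ 2`, so no completeness of `H` is needed. -/
theorem norm_blockOp_le {A : Matrix ι ι (H →L[ℂ] H)} {C : ℝ} (hC : 0 ≤ C)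
    (h : ∀ x y : ι → H, ‖∑ i, ∑ j, inner ℂ (y i) (A i j (x j))‖ ≤
      C * ‖WithLp.toLp 2 x‖ * ‖WithLp.toLp 2 y‖) : ‖blockOp A‖ ≤ C := by
  refine ContinuousLinearMap.opNorm_le_bound _ hC fun x => ?_
  have h1 : ‖inner ℂ (blockOp A x) (blockOp A x)‖ ≤ C * ‖x‖ * ‖blockOp A x‖ := by
    rw [inner_blockOp A x (blockOp A x)]
    exact h x.ofLp (blockOp A x).ofLp
  rw [← inner_self_re_eq_norm, inner_self_eq_norm_sq] at h1
  rcases (norm_nonneg (blockOp A x)).eq_or_lt with h0 | h0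
  · rw [← h0]; positivity
  · rw [pow_two] at h1
    exact le_of_mul_le_mul_right h1 h0

theorem norm_entry_le_norm_blockOp (A : Matrix ι ι (H →L[ℂ] H)) (i j : ι) :
    ‖A i j‖ ≤ ‖blockOp A‖ := by
  classical
  refine ContinuousLinearMap.opNorm_le_of_re_inner_le (blockOp A).opNorm_nonneg fun x y hx hy => ?_
  have h := norm_sum_inner_le A (Pi.single j x) (Pi.single i y)
  rw [norm_toLp_single, norm_toLp_single, hx, hy, mul_one, mul_one, Finset.sum_eq_single i,
    Finset.sum_eq_single j] at h
  · simp only [Pi.single_eq_same] at h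
    refine (RCLike.re_le_norm (K := ℂ) _).trans ?_
    rw [norm_inner_symm]
    exact h
  · intro k _ hk; simp [hk]
  · simp
  · intro k _ hk; simp [hk]
  · simp

/-- Relabelling coordinates is an isometry of the `ℓ²` sums. -/
theorem norm_blockOp_submatrix_le (A : Matrix ι ι (H →L[ℂ] H)) (e : κ ≃ ι) :
    ‖blockOp (A.submatrix e e)‖ ≤ ‖blockOp A‖ := by
  refine norm_blockOp_le (blockOp A).opNorm_nonneg fun x y => ?_
  have h := norm_sum_inner_le A (x ∘ e.symm) (y ∘ e.symm)
  have hx : ∀ z : κ → H, ‖WithLp.toLp 2 (z ∘ e.symm)‖ = ‖WithLp.toLp 2 z‖ := fun z =>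
    norm_toLp_eq (e.symm.sum_comp fun k => ‖z k‖ ^ 2)
  rw [hx, hx] at h
  refine le_of_eq_of_le ?_ h
  congr 1
  rw [← e.sum_comp]
  refine Finset.sum_congr rfl fun i _ => ?_
  rw [← e.sum_comp]
  simp

theorem norm_blockOp_submatrix (A : Matrix ι ι (H →L[ℂ] H)) (e : κ ≃ ι) :
    ‖blockOp (A.submatrix e e)‖ = ‖blockOp A‖ := by
  refine (norm_blockOp_submatrix_le A e).antisymm ?_
  simpa using norm_blockOp_submatrix_le (A.submatrix e e) e.symm

/-- Each block sees only subvectors of `x` and `y`. The bound is crude, but it serves for finiteness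
and for the case of a single block. -/
theorem norm_blockOp_comp_le (A : Matrix ι ι (Matrix κ κ (H →L[ℂ] H))) :
    ‖blockOp (Matrix.comp ι ι κ κ _ A)‖ ≤ ∑ i, ∑ j, ‖blockOp (A i j)‖ := by
  refine norm_blockOp_le (by positivity) fun x y => ?_
  have h : ∑ a, ∑ b, inner ℂ (y a) (Matrix.comp ι ι κ κ _ A a b (x b)) =
      ∑ i, ∑ j, ∑ k, ∑ l, inner ℂ (y (i, k)) (A i j k l (x (j, l))) := by
    simp only [Fintype.sum_prod_type, Matrix.comp_apply]
    exact Finset.sum_congr rfl fun i _ => Finset.sum_comm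
  rw [h, Finset.sum_mul, Finset.sum_mul]
  refine (norm_sum_le _ _).trans (Finset.sum_le_sum fun i _ => ?_)
  rw [Finset.sum_mul, Finset.sum_mul]
  refine (norm_sum_le _ _).trans (Finset.sum_le_sum fun j _ => ?_)
  refine (norm_sum_inner_le (A i j) (fun l => x (j, l)) (fun k => y (i, k))).trans ?_
  gcongr
  · exact norm_toLp_le_of_prod x j
  · exact norm_toLp_le_of_prod y i

end BlockOp

/-! ### Matrix norms coming from operators on a Hilbert space -/

/-- The formal properties of the matrix norms of an operator space used below. -/
class IsOperatorMatrixNorm (V : Type*) [MatrixNorm V] : Prop where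
  mnorm_nonneg : ∀ {ι : Type} [Fintype ι] (A : Matrix ι ι V), 0 ≤ mnorm A
  mnorm_submatrix : ∀ {ι κ : Type} [Fintype ι] [Fintype κ] (A : Matrix ι ι V) (e : κ ≃ ι),
    mnorm (A.submatrix e e) = mnorm A
  mnorm_comp_le : ∀ {ι κ : Type} [Fintype ι] [Fintype κ] (A : Matrix ι ι (Matrix κ κ V)),
    mnorm (Matrix.comp ι ι κ κ V A) ≤ ∑ i, ∑ j, mnorm (A i j)

open OpSpace.IsOperatorMatrixNorm (mnorm_nonneg mnorm_submatrix mnorm_comp_le)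

instance {H : Type v} [NormedAddCommGroup H] [InnerProductSpace ℂ H]
    (E : Submodule ℂ (H →L[ℂ] H)) : IsOperatorMatrixNorm E where
  mnorm_nonneg _ := ContinuousLinearMap.opNorm_nonneg _
  mnorm_submatrix A e := norm_blockOp_submatrix (A.map fun a => (a : H →L[ℂ] H)) e
  mnorm_comp_le A := norm_blockOp_comp_le (A.map fun M => M.map fun a => (a : H →L[ℂ] H))

instance : IsOperatorMatrixNorm ℂ where
  mnorm_nonneg _ := ContinuousLinearMap.opNorm_nonneg _
  mnorm_submatrix A e := norm_blockOp_submatrix (A.map (algebraMap ℂ (ℂ →L[ℂ] ℂ))) e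
  mnorm_comp_le A := norm_blockOp_comp_le (A.map fun M => M.map (algebraMap ℂ (ℂ →L[ℂ] ℂ)))

/-- The shuffle `M_ι(M_κ(V)) = M_κ(M_ι(V))`: it reconciles amplifying a matrix of maps with taking a
matrix of amplified maps. -/
theorem mnorm_comp_swap {V : Type*} [MatrixNorm V] [IsOperatorMatrixNorm V]
    {ι κ : Type} [Fintype ι] [Fintype κ] (A : Matrix ι ι (Matrix κ κ V)) :
    mnorm (Matrix.comp κ κ ι ι V (Matrix.of fun k l => Matrix.of fun i j => A i j k l)) =
      mnorm (Matrix.comp ι ι κ κ V A) :=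
  mnorm_submatrix (Matrix.comp ι ι κ κ V A) (Equiv.prodComm κ ι)

/-! ### Scalar matrices as sesquilinear forms. -/

section Scalar

variable {ι κ : Type} [Fintype ι] [Fintype κ]

theorem norm_sum_mul_le_mnorm (A : Matrix ι ι ℂ) (x y : ι → ℂ) :
    ‖∑ i, ∑ j, star (y i) * (A i j * x j)‖ ≤
      mnorm A * ‖WithLp.toLp 2 x‖ * ‖WithLp.toLp 2 y‖ := by
  have h := norm_sum_inner_le (A.map (algebraMap ℂ (ℂ →L[ℂ] ℂ))) x y
  refine le_of_eq_of_le ?_ h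
  congr 1
  refine Finset.sum_congr rfl fun i _ => Finset.sum_congr rfl fun j _ => ?_
  simp [Algebra.algebraMap_eq_smul_one]
  ring

theorem mnorm_complex_le {A : Matrix ι ι ℂ} {C : ℝ} (hC : 0 ≤ C)
    (h : ∀ x y : ι → ℂ, ‖∑ i, ∑ j, star (y i) * (A i j * x j)‖ ≤
      C * ‖WithLp.toLp 2 x‖ * ‖WithLp.toLp 2 y‖) : mnorm A ≤ C := by
  refine norm_blockOp_le (A := A.map (algebraMap ℂ (ℂ →L[ℂ] ℂ))) hC fun x y => ?_
  refine le_of_eq_of_le ?_ (h x y)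
  congr 1
  refine Finset.sum_congr rfl fun i _ => Finset.sum_congr rfl fun j _ => ?_
  simp [Algebra.algebraMap_eq_smul_one]
  ring

end Scalar

/-! ### Slices and compressions of operator matrices to scalar matrices. -/

section Slice

variable {H : Type v} [NormedAddCommGroup H] [InnerProductSpace ℂ H]
variable {E : Submodule ℂ (H →L[ℂ] H)}
variable {ι κ : Type} [Fintype ι] [Fintype κ]

/-- Slicing a block matrix with vectors of `ℓ²(ι; H)`. -/
theorem mnorm_slice_le (A : Matrix ι ι (Matrix κ κ (H →L[ℂ] H))) (x y : ι → H) :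
    mnorm (Matrix.of fun k l => ∑ i, ∑ j, inner ℂ (y i) (A i j k l (x j))) ≤
      ‖blockOp (Matrix.comp ι ι κ κ _ A)‖ * ‖WithLp.toLp 2 x‖ * ‖WithLp.toLp 2 y‖ := by
  refine mnorm_complex_le (by positivity) fun ξ η => ?_
  -- The form is tested on the elementary tensors `x ⊗ ξ` and `y ⊗ η`, whose norms are products.
  have h := norm_sum_inner_le (Matrix.comp ι ι κ κ _ A) (fun a => ξ a.2 • x a.1)
    (fun a => η a.2 • y a.1)
  have hn : ∀ (ζ : κ → ℂ) (z : ι → H), ‖WithLp.toLp 2 fun a : ι × κ => ζ a.2 • z a.1‖ =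
      ‖WithLp.toLp 2 z‖ * ‖WithLp.toLp 2 ζ‖ := by
    intro ζ z
    rw [← sq_eq_sq₀ (norm_nonneg _) (by positivity), mul_pow, norm_toLp_sq, norm_toLp_sq,
      norm_toLp_sq, Fintype.sum_prod_type, Finset.sum_mul_sum]
    refine Finset.sum_congr rfl fun i _ => Finset.sum_congr rfl fun k _ => ?_
    rw [norm_smul, mul_pow, mul_comm]
  rw [hn, hn] at h
  refine le_of_eq_of_le ?_ (h.trans_eq (by ring))
  congr 1
  simp only [Fintype.sum_prod_type, Matrix.comp_apply, Matrix.of_apply]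
  simp only [map_smul, inner_smul_left, inner_smul_right, Finset.sum_mul, Finset.mul_sum]
  trans ∑ k, ∑ l, ∑ i, ∑ j, star (η k) * (inner ℂ (y i) (A i j k l (x j)) * ξ l)
  · rfl
  rw [Finset.sum_comm (s := (Finset.univ : Finset ι))]
  refine Finset.sum_congr rfl fun k _ => ?_
  rw [Finset.sum_comm]
  refine Finset.sum_congr rfl fun i _ => ?_
  rw [Finset.sum_comm]
  refine Finset.sum_congr rfl fun j _ => Finset.sum_congr rfl fun l _ => ?_
  simp only [Complex.star_def]
  ring

theorem norm_sq_sum_smul {h : κ → H} (hh : Orthonormal ℂ h) (c : κ → ℂ) :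
    ‖∑ s, c s • h s‖ ^ 2 = ∑ s, ‖c s‖ ^ 2 := by
  rw [← inner_self_eq_norm_sq (𝕜 := ℂ), hh.inner_sum, map_sum]
  refine Finset.sum_congr rfl fun s _ => ?_
  rw [RCLike.conj_mul]
  norm_cast

/-- Compressing the entries of a block matrix to the span of an orthonormal family. -/
theorem mnorm_compress_le {r : ℕ} {h : Fin r → H} (hh : Orthonormal ℂ h)
    (A : Matrix ι ι (H →L[ℂ] H)) :
    mnorm (Matrix.of fun a b : ι × Fin r => inner ℂ (h a.2) (A a.1 b.1 (h b.2))) ≤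
      ‖blockOp A‖ := by
  refine mnorm_complex_le (blockOp A).opNorm_nonneg fun ξ η => ?_
  -- Coordinates are turned into vectors of `ℓ²(ι; H)`, isometrically since `h` is orthonormal.
  have h1 := norm_sum_inner_le A (fun i => ∑ s, ξ (i, s) • h s) (fun i => ∑ s, η (i, s) • h s)
  have hn : ∀ ζ : ι × Fin r → ℂ, ‖WithLp.toLp 2 fun i => ∑ s, ζ (i, s) • h s‖ =
      ‖WithLp.toLp 2 ζ‖ := by
    intro ζ
    refine norm_toLp_eq ?_
    rw [Fintype.sum_prod_type]
    exact Finset.sum_congr rfl fun i _ => norm_sq_sum_smul hh _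
  rw [hn, hn] at h1
  refine le_of_eq_of_le ?_ h1
  congr 1
  simp only [Fintype.sum_prod_type, Matrix.of_apply, map_sum, map_smul, sum_inner, inner_sum,
    inner_smul_left, inner_smul_right, Finset.mul_sum]
  refine Finset.sum_congr rfl fun i _ => ?_
  rw [Finset.sum_comm]
  refine Finset.sum_congr rfl fun j _ => ?_
  rw [Finset.sum_comm]
  refine Finset.sum_congr rfl fun t _ => Finset.sum_congr rfl fun s _ => ?_
  simp only [Complex.star_def]
  ring

end Slice

/-! ### The trace pairing -/

section Trace

variable {H : Type v} [NormedAddCommGroup H] [InnerProductSpace ℂ H]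
variable {E : Submodule ℂ (H →L[ℂ] H)}
variable {ι : Type} [Fintype ι] {d : ℕ}

theorem trace_mul_eq_sum (X B : Matrix (Fin d) (Fin d) ℂ) :
    (X * B).trace = ∑ k, ∑ l, B l k * X k l := by
  simp [Matrix.trace, Matrix.mul_apply, mul_comm]

theorem inner_traceMul (A : Matrix (Fin d) (Fin d) E) (B : Matrix (Fin d) (Fin d) ℂ) (x y : H) :
    inner ℂ y ((traceMul A B : E).1 x) =
      ((Matrix.of fun k l => inner ℂ y ((A k l).1 x)) * B).trace := by
  simp [trace_mul_eq_sum, traceMul]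

theorem mnorm_slice_entries_le {κ : Type} [Fintype κ] (A : Matrix κ κ E) (x y : H) :
    mnorm (Matrix.of fun k l => inner ℂ y ((A k l).1 x)) ≤ mnorm A * ‖x‖ * ‖y‖ := by
  have h := mnorm_slice_le (ι := Unit) (Matrix.of fun _ _ => A.map fun a => a.1)
    (fun _ => x) (fun _ => y)
  rw [norm_toLp_const_unit, norm_toLp_const_unit] at h
  refine le_trans (by simpa using h) ?_
  gcongr
  refine (norm_blockOp_comp_le _).trans ?_
  simp
  exact le_rfl

/-- Tested on unit vectors `x`, `y`, the operator becomes `tr (X B)` for the slice `X = (⟨y, A_kl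
x⟩)`, which has norm at most `‖A‖`; the scalar trace inequality finishes. -/
theorem norm_traceMul_le (A : Matrix (Fin d) (Fin d) E) (B : Matrix (Fin d) (Fin d) ℂ) :
    ‖traceMul A B‖ ≤ mnorm A * traceNorm B := by
  have h0 : 0 ≤ mnorm A * traceNorm B := mul_nonneg (mnorm_nonneg A) (traceNorm_nonneg B)
  refine ContinuousLinearMap.opNorm_le_of_re_inner_le (𝕜 := ℂ) (T := (traceMul A B).1) h0
    fun x y hx hy => ?_
  refine (RCLike.re_le_norm (K := ℂ) _).trans ?_
  rw [norm_inner_symm, inner_traceMul]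
  refine (norm_trace_mul_le _ _).trans (mul_le_mul_of_nonneg_right ?_ (traceNorm_nonneg B))
  simpa [hx, hy] using mnorm_slice_entries_le A x y

/-- The functional `X ↦ tr (X B)` is completely bounded with constant `tr |B|`: slicing `A` by `x`
and `y` first reduces every matrix level to the scalar trace inequality. -/
theorem norm_sum_trace_le (A : Matrix ι ι (Matrix (Fin d) (Fin d) ℂ))
    (B : Matrix (Fin d) (Fin d) ℂ) (x y : ι → ℂ) :
    ‖∑ i, ∑ j, star (y i) * ((A i j * B).trace * x j)‖ ≤
      mnorm A * traceNorm B * ‖WithLp.toLp 2 x‖ * ‖WithLp.toLp 2 y‖ := by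
  have h := mnorm_slice_le (A.map fun M => M.map (algebraMap ℂ (ℂ →L[ℂ] ℂ))) x y
  set X : Matrix (Fin d) (Fin d) ℂ := Matrix.of fun k l => ∑ i, ∑ j, inner ℂ (y i)
    ((A.map fun M => M.map (algebraMap ℂ (ℂ →L[ℂ] ℂ))) i j k l (x j)) with hX
  have hX' : X = ∑ i, ∑ j, (star (y i) * x j) • A i j := by
    ext k l
    simp only [hX, Matrix.of_apply, Matrix.sum_apply, Matrix.smul_apply]
    refine Finset.sum_congr rfl fun i _ => Finset.sum_congr rfl fun j _ => ?_
    simp [Algebra.algebraMap_eq_smul_one]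
    ring
  have h1 : ∑ i, ∑ j, star (y i) * ((A i j * B).trace * x j) = (X * B).trace := by
    rw [hX']
    simp only [Finset.sum_mul, Matrix.trace_sum, Matrix.smul_mul, Matrix.trace_smul, smul_eq_mul]
    refine Finset.sum_congr rfl fun i _ => Finset.sum_congr rfl fun j _ => ?_
    ring
  rw [h1]
  refine (norm_trace_mul_le X B).trans
    ((mul_le_mul_of_nonneg_right h (traceNorm_nonneg B)).trans_eq ?_)
  change mnorm A * _ * _ * _ = _
  ring

end Trace

/-! ### Completely bounded maps -/

section CBNorm

variable {V : Type*} [AddCommGroup V] [Module ℂ V] [MatrixNorm V]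
variable {W : Type*} [AddCommGroup W] [Module ℂ W] [MatrixNorm W]

theorem cbNorm_nonneg (u : V →ₗ[ℂ] W) : 0 ≤ cbNorm u := Real.sInf_nonneg fun _ h => h.1

theorem cbNorm_le {u : V →ₗ[ℂ] W} {C : ℝ} (hC : 0 ≤ C) (h : CBBound u C) : cbNorm u ≤ C :=
  csInf_le ⟨0, fun _ h => h.1⟩ ⟨hC, h⟩

/-- The infimum is attained, since the admissible constants form a closed set; existence of one is
needed because `sInf ∅ = 0`. -/
theorem cbBound_cbNorm {u : V →ₗ[ℂ] W} (h : ∃ C : ℝ, 0 ≤ C ∧ CBBound u C) :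
    CBBound u (cbNorm u) := by
  have hc : IsClosed {C : ℝ | 0 ≤ C ∧ CBBound u C} := by
    simp only [CBBound, Set.ofPred_and, Set.ofPred_forall]
    exact isClosed_Ici.inter (isClosed_iInter fun n => isClosed_iInter fun A =>
      isClosed_le continuous_const (by fun_prop))
  exact (hc.csInf_mem h ⟨0, fun _ h => h.1⟩).2

end CBNorm

theorem mnorm_matrix_submatrix {V : Type*} [MatrixNorm V] [IsOperatorMatrixNorm V]
    {ι κ μ : Type} [Fintype ι] [Fintype κ] [Fintype μ]
    (A : Matrix ι ι (Matrix μ μ V)) (e : κ ≃ ι) : mnorm (A.submatrix e e) = mnorm A :=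
  mnorm_submatrix (Matrix.comp ι ι μ μ V A) (e.prodCongr (Equiv.refl μ))

/-! ### `L^∞` and `L^1` of the dual object -/

section DualObject

variable {G : Type u} [Group G] [TopologicalSpace G]
variable {V : Type v} [AddCommGroup V] [Module ℂ V] [MatrixNorm V] [IsMatrixSeminorm V]
variable {ι κ : Type} [Fintype ι] [Fintype κ]

theorem mnorm_lInf_le {A : Matrix ι ι (LInf G V)} {C : ℝ} (hC : 0 ≤ C)
    (h : ∀ π, mnorm (A.map fun a => (a : MatrixFamily G V) π) ≤ C) : mnorm A ≤ C :=
  Real.iSup_le h hC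

variable [IsOperatorMatrixNorm V]

theorem mnorm_proj_le (A : Matrix ι ι (LInf G V)) (π : DualObject G) :
    mnorm (A.map fun a => (a : MatrixFamily G V) π) ≤ mnorm A := by
  refine le_ciSup (f := fun π : DualObject G => mnorm (A.map fun a => (a : MatrixFamily G V) π))
    ?_ π
  -- A real supremum dominates its terms only if they are bounded above; the bounds of the entries
  -- provide this.
  choose C hC using fun i j => (A i j).2
  refine ⟨∑ i, ∑ j, C i j, ?_⟩
  rintro _ ⟨π, rfl⟩
  exact (mnorm_comp_le (A.map fun a => (a : MatrixFamily G V) π)).trans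
    (Finset.sum_le_sum fun i _ => Finset.sum_le_sum fun j _ => hC i j π)

theorem mnorm_lInf_nonneg (A : Matrix ι ι (LInf G V)) : 0 ≤ mnorm A :=
  Real.iSup_nonneg fun π => mnorm_nonneg
    (Matrix.comp ι ι _ _ V (A.map fun a => (a : MatrixFamily G V) π))

theorem mnorm_lInf_submatrix (A : Matrix ι ι (LInf G V)) (e : κ ≃ ι) :
    mnorm (A.submatrix e e) = mnorm A :=
  iSup_congr fun π => mnorm_matrix_submatrix (A.map fun a => (a : MatrixFamily G V) π) e

/-- The norm `∑_π d_π tr |B^π|` of `L^1(Ĝ)`. -/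
noncomputable def lOneNorm (B : LOne G) : ℝ :=
  ∑' π : DualObject G, (π.deg : ℝ) * traceNorm (B.1 π)

theorem lOneNorm_nonneg (B : LOne G) : 0 ≤ lOneNorm B :=
  tsum_nonneg fun _ => mul_nonneg (Nat.cast_nonneg _) (traceNorm_nonneg _)

/-- For fixed test vectors the form is a series over `π`, estimated termwise by `norm_sum_trace_le`.
-/
theorem mnorm_map_pairing_le (X : Matrix ι ι (LInf G ℂ)) (B : LOne G) :
    mnorm (X.map (pairing B)) ≤ lOneNorm B * mnorm X := by
  refine mnorm_complex_le (mul_nonneg (lOneNorm_nonneg B) (mnorm_lInf_nonneg X)) fun x y => ?_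
  have h1 : HasSum (fun π : DualObject G => ∑ i, ∑ j,
      star (y i) * ((π.deg : ℂ) * ((X i j).1 π * B.1 π).trace * x j))
      (∑ i, ∑ j, star (y i) * ((X.map (pairing B)) i j * x j)) :=
    hasSum_sum fun i _ => hasSum_sum fun j _ =>
      ((summable_pairing B (X i j)).hasSum.mul_right _).mul_left _
  have h2 : HasSum (fun π : DualObject G => (π.deg : ℝ) * traceNorm (B.1 π) *
      (mnorm X * ‖WithLp.toLp 2 x‖ * ‖WithLp.toLp 2 y‖))
      (lOneNorm B * (mnorm X * ‖WithLp.toLp 2 x‖ * ‖WithLp.toLp 2 y‖)) :=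
    B.2.hasSum.mul_right _
  rw [← h1.tsum_eq]
  refine (tsum_of_norm_bounded h2 fun π => ?_).trans_eq (by ring)
  have h3 : ∑ i, ∑ j, star (y i) * ((π.deg : ℂ) * ((X i j).1 π * B.1 π).trace * x j) =
      (π.deg : ℂ) * ∑ i, ∑ j, star (y i) * (((X i j).1 π * B.1 π).trace * x j) := by
    simp only [Finset.mul_sum]
    refine Finset.sum_congr rfl fun i _ => Finset.sum_congr rfl fun j _ => ?_
    ring
  rw [h3, norm_mul, Complex.norm_natCast, mul_assoc]
  refine mul_le_mul_of_nonneg_left ?_ (Nat.cast_nonneg _)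
  refine (norm_sum_trace_le (X.map fun a => (a : MatrixFamily G ℂ) π) (B.1 π) x y).trans ?_
  calc _ ≤ mnorm X * traceNorm (B.1 π) * ‖WithLp.toLp 2 x‖ * ‖WithLp.toLp 2 y‖ := by
        gcongr
        · exact traceNorm_nonneg _
        · exact mnorm_proj_le X π
    _ = _ := by ring

/-- Some finite bound must exist for the infimum defining the norm of `M_κ(L^1)` to be a bound
itself. -/
theorem cbBound_pairing (B : Matrix κ κ (LOne G)) :
    CBBound (matrixOfMaps (B.map pairing)) (∑ p, ∑ q, lOneNorm (B p q)) := by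
  intro n X
  have h := mnorm_comp_le (Matrix.of fun p q => X.map (pairing (B p q)))
  rw [← mnorm_comp_swap] at h
  refine h.trans ?_
  simp only [Finset.sum_mul]
  exact Finset.sum_le_sum fun p _ => Finset.sum_le_sum fun q _ => mnorm_map_pairing_le X (B p q)

theorem sum_lOneNorm_nonneg (B : Matrix κ κ (LOne G)) : 0 ≤ ∑ p, ∑ q, lOneNorm (B p q) :=
  Finset.sum_nonneg fun _ _ => Finset.sum_nonneg fun _ _ => lOneNorm_nonneg _

theorem mnorm_lOne_le (B : Matrix κ κ (LOne G)) : mnorm B ≤ ∑ p, ∑ q, lOneNorm (B p q) :=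
  cbNorm_le (sum_lOneNorm_nonneg B) (cbBound_pairing B)

theorem mnorm_lOne_nonneg (B : Matrix κ κ (LOne G)) : 0 ≤ mnorm B := cbNorm_nonneg _

/-- `CBBound` speaks of `Fin n` only; relabelling extends it to every finite index type. -/
theorem mnorm_map_matrixOfMaps_pairing_le (B : Matrix κ κ (LOne G)) (X : Matrix ι ι (LInf G ℂ)) :
    mnorm (X.map (matrixOfMaps (B.map pairing))) ≤ mnorm B * mnorm X := by
  have h := cbBound_cbNorm ⟨_, sum_lOneNorm_nonneg B, cbBound_pairing B⟩ _
    (X.submatrix (Fintype.equivFin ι).symm (Fintype.equivFin ι).symm)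
  rw [mnorm_lInf_submatrix] at h
  rwa [← mnorm_matrix_submatrix _ (Fintype.equivFin ι).symm]

end DualObject

/-! ### The duality between `L^∞_E` and `L^1` -/

section Duality

variable {G : Type u} [Group G] [TopologicalSpace G]
variable {H : Type v} [NormedAddCommGroup H] [InnerProductSpace ℂ H]
variable {E : Submodule ℂ (H →L[ℂ] H)}
variable {ι κ : Type} [Fintype ι] [Fintype κ]

/-- The matrix coefficients `⟨y, A x⟩` of a bounded family `A` of matrices of operators. -/
noncomputable def coefficient (y x : H) (A : LInf G E) : LInf G ℂ :=
  ⟨fun π => Matrix.of fun k l => inner ℂ y ((A.1 π k l).1 x), by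
    obtain ⟨C, hC⟩ := A.2
    refine ⟨C * ‖x‖ * ‖y‖, fun π => (mnorm_slice_entries_le (A.1 π) x y).trans ?_⟩
    gcongr
    exact hC π⟩

/-- At each `π` this is the compression of `A^π` to the span of `h`, once the index in `Fin r` has
been moved past the one in `Fin π.deg` by `e`. -/
theorem mnorm_coefficient_le {r : ℕ} {h : Fin r → H} (hh : Orthonormal ℂ h)
    (A : Matrix ι ι (LInf G E)) :
    mnorm (Matrix.of fun a b : ι × Fin r => coefficient (h a.2) (h b.2) (A a.1 b.1)) ≤
      mnorm A := by
  refine mnorm_lInf_le (mnorm_lInf_nonneg A) fun π => ?_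
  refine le_trans ?_ (mnorm_proj_le A π)
  let Aπ := A.map fun a => (a : MatrixFamily G E) π
  refine le_of_eq_of_le ?_ (mnorm_compress_le hh
    ((Matrix.comp ι ι _ _ E Aπ).map fun a => (a : H →L[ℂ] H)))
  let e : (ι × Fin r) × Fin π.deg ≃ (ι × Fin π.deg) × Fin r :=
    ⟨fun a => ((a.1.1, a.2), a.1.2), fun a => ((a.1.1, a.2), a.1.2), fun _ => rfl, fun _ => rfl⟩
  exact mnorm_submatrix (Matrix.of fun a b : (ι × Fin π.deg) × Fin r => inner ℂ (h a.2)
    (((Matrix.comp ι ι _ _ E Aπ).map fun a => (a : H →L[ℂ] H)) a.1 b.1 (h b.2))) e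

theorem exists_orthonormal_coordinates {α : Type} [Finite α] (z : α → H) :
    ∃ (r : ℕ) (h : Fin r → H), Orthonormal ℂ h ∧ ∀ a, ∑ s, inner ℂ (h s) (z a) • h s = z a := by
  let K := Submodule.span ℂ (Set.range z)
  have : FiniteDimensional ℂ K := FiniteDimensional.span_of_finite ℂ (Set.finite_range z)
  let b := stdOrthonormalBasis ℂ K
  refine ⟨_, fun s => (b s : H), b.orthonormal.comp_linearIsometry K.subtypeₗᵢ, fun a => ?_⟩
  have := congrArg Subtype.val (b.sum_repr' ⟨z a, Submodule.subset_span ⟨a, rfl⟩⟩)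
  simpa using this

variable [CompleteSpace E]

theorem summable_traceMul (A : LInf G E) (B : LOne G) :
    Summable fun π : DualObject G => (π.deg : ℂ) • traceMul (A.1 π) (B.1 π) := by
  obtain ⟨C, hC⟩ := A.2
  refine Summable.of_norm_bounded (Summable.mul_left C B.2) fun π => ?_
  change ‖(π.deg : ℂ) • (traceMul (A.1 π) (B.1 π)).1‖ ≤ _
  rw [norm_smul, Complex.norm_natCast, mul_left_comm]
  exact mul_le_mul_of_nonneg_left ((norm_traceMul_le _ _).trans
    (mul_le_mul_of_nonneg_right (hC π) (traceNorm_nonneg _))) (Nat.cast_nonneg _)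

/-- The map `B ↦ ∑_π d_π tr (A^π B^π)` from `L^1(Ĝ)` to `E` given by `A ∈ L^∞_E(Ĝ)`. -/
noncomputable def duality (A : LInf G E) : LOne G →ₗ[ℂ] E where
  toFun B := ∑' π : DualObject G, (π.deg : ℂ) • traceMul (A.1 π) (B.1 π)
  map_add' B C := by
    rw [← (summable_traceMul A B).tsum_add (summable_traceMul A C)]
    refine tsum_congr fun π => ?_
    simp [traceMul, add_smul, Finset.sum_add_distrib]
  map_smul' c B := by
    rw [RingHom.id_apply, ← (summable_traceMul A B).tsum_const_smul]
    refine tsum_congr fun π => ?_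
    simp only [traceMul, Finset.smul_sum, smul_smul]
    refine Finset.sum_congr rfl fun i _ => Finset.sum_congr rfl fun j _ => ?_
    simp [mul_left_comm]

theorem hasSum_duality (A : LInf G E) (B : LOne G) :
    HasSum (fun π : DualObject G => (π.deg : ℂ) • traceMul (A.1 π) (B.1 π)) (duality A B) :=
  (summable_traceMul A B).hasSum

theorem inner_duality (A : LInf G E) (B : LOne G) (x y : H) :
    inner ℂ y ((duality A B).1 x) = pairing B (coefficient y x A) := by
  let f : E →L[ℂ] ℂ := innerSL ℂ y ∘L ContinuousLinearMap.apply ℂ H x ∘L E.subtypeL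
  refine (((hasSum_duality A B).mapL f).tsum_eq.symm).trans (tsum_congr fun π => ?_)
  rw [map_smul, smul_eq_mul]
  exact congrArg _ (inner_traceMul (A.1 π) (B.1 π) x y)

theorem mnorm_duality_le (A : Matrix ι ι (LInf G E)) (B : Matrix κ κ (LOne G)) :
    mnorm (B.map (matrixOfMaps (A.map duality))) ≤ mnorm A * mnorm B := by
  refine norm_blockOp_le (mul_nonneg (mnorm_lInf_nonneg A) (mnorm_lOne_nonneg B)) fun x y => ?_
  -- One orthonormal family carries all entries of both `x` and `y`.
  obtain ⟨r, h, hh, hz⟩ := exists_orthonormal_coordinates (Sum.elim x y)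
  have hx : ∀ a, ∑ s, inner ℂ (h s) (x a) • h s = x a := fun a => hz (Sum.inl a)
  have hy : ∀ a, ∑ s, inner ℂ (h s) (y a) • h s = y a := fun a => hz (Sum.inr a)
  set X := Matrix.of fun a b : ι × Fin r => coefficient (h a.2) (h b.2) (A a.1 b.1) with hX
  -- The scalar matrix is tested on the coordinates of `x` and `y` in `h`, rearranged from `κ × ι`
  -- to `(ι × Fin r) × κ`.
  have h1 := norm_sum_mul_le_mnorm
    (Matrix.comp _ _ _ _ ℂ (X.map (matrixOfMaps (B.map pairing))))
    (fun a => inner ℂ (h a.1.2) (x (a.2, a.1.1))) (fun a => inner ℂ (h a.1.2) (y (a.2, a.1.1)))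
  have hn : ∀ z : κ × ι → H, (∀ a, ∑ s, inner ℂ (h s) (z a) • h s = z a) →
      ‖WithLp.toLp 2 fun a : (ι × Fin r) × κ => inner ℂ (h a.1.2) (z (a.2, a.1.1))‖ =
        ‖WithLp.toLp 2 z‖ := by
    intro z hz
    refine norm_toLp_eq ?_
    simp only [Fintype.sum_prod_type]
    rw [Finset.sum_comm_cycle]
    refine Finset.sum_congr rfl fun p _ => Finset.sum_congr rfl fun i _ => ?_
    rw [← norm_sq_sum_smul hh, hz]
  rw [hn x hx, hn y hy] at h1
  have h2 : mnorm (X.map (matrixOfMaps (B.map pairing))) ≤ mnorm A * mnorm B := by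
    refine (mnorm_map_matrixOfMaps_pairing_le B X).trans ?_
    rw [mul_comm]
    exact mul_le_mul_of_nonneg_right (mnorm_coefficient_le hh A) (mnorm_lOne_nonneg B)
  -- Expanding both vectors in `h` identifies the operator form with the scalar form of `h1`.
  have key : ∀ (T : H →L[ℂ] H) (a b : κ × ι), inner ℂ (y a) (T (x b)) =
      ∑ s, ∑ t, star (inner ℂ (h s) (y a)) * (inner ℂ (h s) (T (h t)) * inner ℂ (h t) (x b)) := by
    intro T a b
    conv_lhs => rw [← hx b, ← hy a]
    simp only [map_sum, map_smul, sum_inner, inner_sum, inner_smul_left, inner_smul_right,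
      Finset.mul_sum, Complex.star_def]
    rw [Finset.sum_comm]
    refine Finset.sum_congr rfl fun s _ => Finset.sum_congr rfl fun t _ => ?_
    ring
  refine le_trans (le_of_eq_of_le ?_ h1) (by gcongr; exact h2)
  congr 1
  simp only [key, Fintype.sum_prod_type]
  symm
  rw [Finset.sum_comm_cycle]
  refine Finset.sum_congr rfl fun p _ => Finset.sum_congr rfl fun i _ => ?_
  symm
  rw [Finset.sum_comm_cycle]
  refine Finset.sum_congr rfl fun s _ => ?_
  symm
  rw [Finset.sum_comm_cycle]
  refine Finset.sum_congr rfl fun q _ => Finset.sum_congr rfl fun j _ =>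
    Finset.sum_congr rfl fun t _ => ?_
  congr 2
  exact (inner_duality (A i j) (B p q) (h t) (h s)).symm

end Duality

/-! ### Families supported at one point -/

section Single

variable {G : Type u} [Group G] [TopologicalSpace G]
variable {H : Type v} [NormedAddCommGroup H] [InnerProductSpace ℂ H]
variable {E : Submodule ℂ (H →L[ℂ] H)}
variable {ι κ : Type} [Fintype ι] [Fintype κ]

theorem traceNorm_zero {d : ℕ} : traceNorm (0 : Matrix (Fin d) (Fin d) ℂ) = 0 :=
  le_antisymm (by simpa using traceNorm_smul_le 0 (0 : Matrix (Fin d) (Fin d) ℂ))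
    (traceNorm_nonneg _)

open Classical in
/-- The family with the value `M` at `π` and `0` elsewhere. -/
noncomputable def lOneSingle (π : DualObject G) :
    Matrix (Fin π.deg) (Fin π.deg) ℂ →ₗ[ℂ] LOne G :=
  (LinearMap.single ℂ (fun π : DualObject G => Matrix (Fin π.deg) (Fin π.deg) ℂ) π).codRestrict
    (LOne G) fun M => by
      refine summable_of_ne_finset_zero (s := {π}) fun σ hσ => ?_
      rw [LinearMap.single_apply, Pi.single_eq_of_ne (by simpa using hσ), traceNorm_zero, mul_zero]

theorem lOneSingle_apply_same (π : DualObject G) (M : Matrix (Fin π.deg) (Fin π.deg) ℂ) :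
    (lOneSingle π M).1 π = M := by
  classical
  exact Pi.single_eq_same
    (M := fun π : DualObject G => Matrix (Fin π.deg) (Fin π.deg) ℂ) π M

theorem lOneSingle_apply_of_ne {π σ : DualObject G} (h : σ ≠ π)
    (M : Matrix (Fin π.deg) (Fin π.deg) ℂ) : (lOneSingle π M).1 σ = 0 := by
  classical
  exact Pi.single_eq_of_ne
    (M := fun π : DualObject G => Matrix (Fin π.deg) (Fin π.deg) ℂ) h M

theorem pairing_lOneSingle (π : DualObject G) (M : Matrix (Fin π.deg) (Fin π.deg) ℂ)
    (X : LInf G ℂ) : pairing (lOneSingle π M) X = (π.deg : ℂ) * (X.1 π * M).trace := by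
  refine (tsum_eq_single π fun σ hσ => ?_).trans ?_
  · simp [lOneSingle_apply_of_ne hσ]
  · rw [lOneSingle_apply_same]

theorem duality_lOneSingle [CompleteSpace E] (π : DualObject G)
    (M : Matrix (Fin π.deg) (Fin π.deg) ℂ) (A : LInf G E) :
    duality A (lOneSingle π M) = (π.deg : ℂ) • traceMul (A.1 π) M := by
  refine (tsum_eq_single π fun σ hσ => ?_).trans ?_
  · simp [lOneSingle_apply_of_ne hσ, traceMul]
  · rw [lOneSingle_apply_same]

/-- The matrix of elements of `L^1(Ĝ)` dual to the matrix units at `π`. -/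
noncomputable def dualUnits (π : DualObject G) : Matrix (Fin π.deg) (Fin π.deg) (LOne G) :=
  -- The factor `d_π⁻¹` cancels the weight of the pairing, and the indices are transposed because
  -- `tr (X e_qp) = X_pq`.
  Matrix.of fun p q => lOneSingle π ((π.deg : ℂ)⁻¹ • Matrix.single q p 1)

/-- An index below `d` already forces `d ≠ 0`, so a degree can be inverted wherever an entry is at
hand. -/
theorem deg_ne_zero_of_fin {d : ℕ} (p : Fin d) : (d : ℂ) ≠ 0 := by
  exact_mod_cast (Fin.pos p).ne'

theorem traceMul_single {V : Type*} [AddCommGroup V] [Module ℂ V] {d : ℕ}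
    (A : Matrix (Fin d) (Fin d) V) (p q : Fin d) (c : ℂ) :
    traceMul A (c • Matrix.single q p 1) = c • A p q := by
  rw [traceMul, Finset.sum_eq_single p, Finset.sum_eq_single q]
  · simp
  · intro l _ hl; simp [hl.symm]
  · simp
  · intro k _ hk; simp [hk.symm]
  · simp

theorem pairing_dualUnits (π : DualObject G) (p q : Fin π.deg) (X : LInf G ℂ) :
    pairing (dualUnits π p q) X = X.1 π p q := by
  have h : ((X.1 π) * ((π.deg : ℂ)⁻¹ • Matrix.single q p 1)).trace =
      traceMul (X.1 π) ((π.deg : ℂ)⁻¹ • Matrix.single q p 1) := trace_mul_eq_sum _ _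
  rw [dualUnits, Matrix.of_apply, pairing_lOneSingle, h, traceMul_single, smul_eq_mul,
    mul_inv_cancel_left₀ (deg_ne_zero_of_fin p)]

theorem duality_dualUnits [CompleteSpace E] (π : DualObject G) (p q : Fin π.deg) (A : LInf G E) :
    duality A (dualUnits π p q) = A.1 π p q := by
  rw [dualUnits, Matrix.of_apply, duality_lOneSingle, traceMul_single,
    smul_inv_smul₀ (deg_ne_zero_of_fin p)]

/-- As a map on `L^∞` this matrix is the projection to the component at `π`, a contraction at all
matrix levels. -/
theorem mnorm_dualUnits_le (π : DualObject G) : mnorm (dualUnits π) ≤ 1 := by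
  refine cbNorm_le zero_le_one fun n X => ?_
  rw [one_mul]
  refine le_of_eq_of_le ?_ (mnorm_proj_le X π)
  congr 1
  ext i j p q
  exact pairing_dualUnits π p q (X i j)

theorem lOneSingle_eq_sum (π : DualObject G) (M : Matrix (Fin π.deg) (Fin π.deg) ℂ) :
    lOneSingle π M = (π.deg : ℂ) • ∑ k, ∑ l, M l k • dualUnits π k l := by
  conv_lhs => rw [Matrix.matrix_eq_sum_single M]
  rw [Finset.sum_comm]
  simp only [map_sum, Finset.smul_sum]
  refine Finset.sum_congr rfl fun k _ => Finset.sum_congr rfl fun l _ => ?_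
  rw [dualUnits, Matrix.of_apply, map_smul, smul_comm (M l k),
    smul_inv_smul₀ (deg_ne_zero_of_fin k),
    ← map_smul, Matrix.smul_single, smul_eq_mul, mul_one]

end Single

/-! ### The completely isometric isomorphism -/

section Isomorphism

variable {G : Type u} [Group G] [TopologicalSpace G]
variable {H : Type v} [NormedAddCommGroup H] [InnerProductSpace ℂ H]
variable {E : Submodule ℂ (H →L[ℂ] H)}

/-- Only the level of `1 × 1` matrices is needed. -/
theorem norm_le_of_cbBound {u : LOne G →ₗ[ℂ] E} {C : ℝ} (hC : 0 ≤ C) (hu : CBBound u C)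
    (B : LOne G) : ‖u B‖ ≤ C * lOneNorm B := by
  let B' : Matrix (Fin 1) (Fin 1) (LOne G) := Matrix.of fun _ _ => B
  have h1 : ‖u B‖ ≤ mnorm (B'.map u) :=
    norm_entry_le_norm_blockOp ((B'.map u).map fun a => (a : H →L[ℂ] H)) 0 0
  refine h1.trans ((hu 1 B').trans (mul_le_mul_of_nonneg_left ?_ hC))
  refine (mnorm_lOne_le B').trans_eq ?_
  simp [B']

open Classical in
theorem sub_sum_lOneSingle_apply (B : LOne G) (s : Finset (DualObject G)) (π : DualObject G) :
    (B - ∑ σ ∈ s, lOneSingle σ (B.1 σ)).1 π = if π ∈ s then 0 else B.1 π := by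
  have h : (∑ σ ∈ s, lOneSingle σ (B.1 σ)).1 π = ∑ σ ∈ s, (lOneSingle σ (B.1 σ)).1 π := by
    simp
  change B.1 π - (∑ σ ∈ s, lOneSingle σ (B.1 σ)).1 π = _
  rw [h]
  split_ifs with hπ
  · rw [Finset.sum_eq_single_of_mem π hπ fun σ _ hσ => lOneSingle_apply_of_ne hσ.symm _,
      lOneSingle_apply_same, sub_self]
  · rw [Finset.sum_eq_zero fun σ hσ => lOneSingle_apply_of_ne
      (fun h : π = σ => hπ (h ▸ hσ)) _, sub_zero]

/-- The error after a finite set `s` is `u` of the part of `B` off `s`, hence at most `C` times the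
tail of the series defining `lOneNorm B`. -/
theorem hasSum_lOneSingle {u : LOne G →ₗ[ℂ] E} {C : ℝ} (hC : 0 ≤ C) (hu : CBBound u C)
    (B : LOne G) : HasSum (fun π => u (lOneSingle π (B.1 π))) (u B) := by
  have h0 : Filter.Tendsto (fun s : Finset (DualObject G) =>
      C * ∑' π : {π // π ∉ s}, ((π : DualObject G).deg : ℝ) * traceNorm (B.1 π))
      Filter.atTop (nhds 0) := by
    simpa using (tendsto_tsum_compl_atTop_zero
      fun π : DualObject G => (π.deg : ℝ) * traceNorm (B.1 π)).const_mul C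
  refine tendsto_iff_norm_sub_tendsto_zero.2
    (squeeze_zero (fun _ => norm_nonneg _) (fun s => ?_) h0)
  rw [norm_sub_rev, ← map_sum, ← map_sub]
  refine (norm_le_of_cbBound hC hu _).trans_eq ?_
  congr 1
  rw [lOneNorm]
  refine Eq.trans (tsum_congr fun π => ?_) (tsum_subtype (s : Set (DualObject G))ᶜ
    fun π : DualObject G => (π.deg : ℝ) * traceNorm (B.1 π)).symm
  rw [sub_sum_lOneSingle_apply]
  by_cases hπ : π ∈ s <;> simp [hπ, traceNorm_zero]

variable [CompleteSpace E]

theorem cbBound_duality {ι : Type} [Fintype ι] (A : Matrix ι ι (LInf G E)) :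
    CBBound (matrixOfMaps (A.map duality)) (mnorm A) := fun _ B => mnorm_duality_le A B

theorem duality_mem_CB (A : LInf G E) : duality A ∈ CB (LOne G) E := by
  -- The matrix estimate is used for `A` as a `1 × 1` matrix, and the trivial index is then removed.
  let A' : Matrix Unit Unit (LInf G E) := Matrix.of fun _ _ => A
  refine ⟨mnorm A', mnorm_lInf_nonneg A', fun n B => ?_⟩
  refine le_of_eq_of_le ?_ (mnorm_duality_le A' B)
  exact (mnorm_submatrix (B.map (duality A)) (Equiv.prodPUnit (Fin n))).symm

/-- The map `A ↦ (B ↦ ∑_π d_π tr (A^π B^π))` from `L^∞_E(Ĝ)` to `cb(L^1(Ĝ), E)`. -/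
noncomputable def dualityMap : LInf G E →ₗ[ℂ] CB (LOne G) E where
  toFun A := ⟨duality A, duality_mem_CB A⟩
  map_add' A A' := by
    ext1
    ext1 B
    refine (HasSum.unique ?_ (hasSum_duality (A + A') B)).symm
    refine ((hasSum_duality A B).add (hasSum_duality A' B)).congr_fun fun π => ?_
    simp [traceMul, Finset.sum_add_distrib]
  map_smul' c A := by
    ext1
    ext1 B
    refine (HasSum.unique ?_ (hasSum_duality (c • A) B)).symm
    refine ((hasSum_duality A B).const_smul c).congr_fun fun π => ?_
    simp only [traceMul, Finset.smul_sum]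
    refine Finset.sum_congr rfl fun i _ => Finset.sum_congr rfl fun j _ => ?_
    change _ = c • (π.deg : ℂ) • (B.1 π) j i • A.1 π i j
    rw [smul_comm c, smul_comm c]
    rfl

theorem dualityMap_injective : Function.Injective (dualityMap : LInf G E →ₗ[ℂ] CB (LOne G) E) := by
  intro A A' h
  ext1
  funext π
  ext1 p q
  rw [← duality_dualUnits π p q A, ← duality_dualUnits π p q A']
  exact congrArg (fun u : CB (LOne G) E => u.1 (dualUnits π p q)) h

/-- The preimage is `A^π = u(dualUnits π)`, bounded by `C`. It works on families supported at one
point, which are combinations of the dual units, and summing over `π` gives all of `L^1`. -/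
theorem dualityMap_surjective :
    Function.Surjective (dualityMap : LInf G E →ₗ[ℂ] CB (LOne G) E) := by
  rintro ⟨u, C, hC, hu⟩
  refine ⟨⟨fun π => (dualUnits π).map u, C, fun π => (hu _ _).trans ?_⟩, ?_⟩
  · exact mul_le_of_le_one_right hC (mnorm_dualUnits_le π)
  · ext1
    ext1 B
    refine (hasSum_duality _ B).unique ((hasSum_lOneSingle hC hu B).congr_fun fun π => ?_)
    rw [lOneSingle_eq_sum]
    simp [traceMul]

theorem dualityMap_isCompleteIsometry :
    IsCompleteIsometry (dualityMap : LInf G E →ₗ[ℂ] CB (LOne G) E) := by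
  intro n A
  change cbNorm (matrixOfMaps (A.map duality)) = mnorm A
  refine (cbNorm_le (mnorm_lInf_nonneg A) (cbBound_duality A)).antisymm ?_
  refine mnorm_lInf_le (cbNorm_nonneg _) fun π => ?_
  -- The amplification to level `d_π`, applied to the dual units, yields `(A_ij^π)` up to the
  -- shuffle of the two indices.
  have h := cbBound_cbNorm ⟨_, mnorm_lInf_nonneg A, cbBound_duality A⟩ _ (dualUnits π)
  refine le_trans (le_of_eq ?_)
    (h.trans (mul_le_of_le_one_right (cbNorm_nonneg _) (mnorm_dualUnits_le π)))
  refine (mnorm_comp_swap (A.map fun a => (a : MatrixFamily G E) π)).symm.trans ?_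
  congr 1
  ext1 a b
  exact (duality_dualUnits π a.1 b.1 (A a.2 b.2)).symm

end Isomorphism

end OpSpace

theorem mainTheorem5 {G : Type*} [Group G] [TopologicalSpace G] [IsTopologicalGroup G]
    [CompactSpace G] [T2Space G]
    {H : Type*} [NormedAddCommGroup H] [InnerProductSpace ℂ H] [CompleteSpace H]
    (E : Submodule ℂ (H →L[ℂ] H)) (hE : IsClosed (E : Set (H →L[ℂ] H))) :
    ∃ Λ : LInf G E ≃ₗ[ℂ] CB (LOne G) E,
      (∀ (A : LInf G E) (B : LOne G),
        HasSum (fun π : DualObject G => (π.deg : ℂ) • traceMul (A.1 π) (B.1 π)) ((Λ A).1 B)) ∧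
      IsCompleteIsometry Λ := by
  -- Completeness of `E` turns the absolute convergence of the series into convergence inside `E`.
  have : CompleteSpace E := hE.completeSpace_coe
  exact ⟨LinearEquiv.ofBijective dualityMap ⟨dualityMap_injective, dualityMap_surjective⟩,
    hasSum_duality, dualityMap_isCompleteIsometry⟩
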